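/- Theorem 1.5. Let $\mathbb B_2=\{x\in\mathbb R^2:\|x\|\le 1\}$ be the Euclidean unit disk, and let $K\subset\mathbb R^2$ be a convex body (a compact convex set with nonempty interior). For $u\in\mathbb R^2\setminus\{0\}$ let $$b_u(K,\mathbb B_2)=\frac{\max_{x,y\in K}u^{T}(x-y)}{\max_{x\in\mathbb B_2}u^{T}x},\qquad w(K,\mathbb B_2)=\min_{u\ne 0}b_u(K,\mathbb B_2),\qquad D(K,\mathbb B_2)=\max_{u\neq 0}b_u(K,\mathbb B_2),$$ $$r(K,\mathbb B_2)=\sup\{\rho>0:\ t+\rho\,\mathbb B_2\subset K\text{ for some }t\in\mathbb R^2\},\qquad R(K,\mathbb B_2)=\inf\{\rho>0:\ K\subset t+\rho\,\mathbb B_2\text{ for some }t\in\mathbb R^2\}.$$ Call $K$ pseudo-complete with respect to $\mathbb B_2$ if $r(K,\mathbb B_2)+R(K,\mathbb B_2)=D(K,\mathbb B_2)$. Put $$t=\sqrt[3]{\tfrac{32}{9}}\left(\sqrt[3]{9+\sqrt{69}}+\sqrt[3]{9-\sqrt{69}}\right),\qquad r=\frac12\left(\sqrt t+\sqrt{\frac{16}{\sqrt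 t}-t}\right)-1 .$$ Then $0.7935<r<0.7936$ and $1.1300<\frac12\left(1+\frac1r\right)<1.1301$, and every convex body $K\subset\mathbb R^2$ that is pseudo-complete with respect to $\mathbb B_2$ satisfies $$\frac{D(K,\mathbb B_2)}{w(K,\mathbb B_2)}\le\frac12\left(1+\frac1r\right).$$ Moreover, the hood $$\mathbb H=\mathrm{conv}\left(\left\{\begin{pmatrix}0\\1\end{pmatrix},\begin{pmatrix}r\\-\sqrt{1-r^2}\end{pmatrix},\begin{pmatrix}-r\\-\sqrt{1-r^2}\end{pmatrix}\right\}\cup r\,\mathbb B_2\right),$$ and every set similar to it, is a convex body that is pseudo-complete with respect to $\mathbb B_2$ and satisfies this inequality with equality. -/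

import Mathlib

open scoped Pointwise

noncomputable section

namespace MinkowskiGeom

/-- A (convex) body in `ℝⁿ`: a compact convex set with nonempty interior. -/
def IsBody {n : ℕ} (K : Set (EuclideanSpace ℝ (Fin n))) : Prop :=
  Convex ℝ K ∧ IsCompact K ∧ (interior K).Nonempty

/-- The `u`-breadth of `K` with respect to `C`:
`b_u(K, C) = (max_{x, y ∈ K} uᵀ(x - y)) / (max_{x ∈ C} uᵀx)`. -/
def breadth {n : ℕ} (K C : Set (EuclideanSpace ℝ (Fin n))) (u : EuclideanSpace ℝ (Fin n)) : ℝ :=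
  sSup {a : ℝ | ∃ x ∈ K, ∃ y ∈ K, a = inner ℝ u (x - y)} /
    sSup {a : ℝ | ∃ x ∈ C, a = inner ℝ u x}

/-- The width `w(K, C)`: the minimal breadth over all directions `u ≠ 0`. -/
def width {n : ℕ} (K C : Set (EuclideanSpace ℝ (Fin n))) : ℝ :=
  sInf {b : ℝ | ∃ u : EuclideanSpace ℝ (Fin n), u ≠ 0 ∧ b = breadth K C u}

/-- The diameter `D(K, C)`: the maximal breadth over all directions `u ≠ 0`. -/
def diameter {n : ℕ} (K C : Set (EuclideanSpace ℝ (Fin n))) : ℝ :=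
  sSup {b : ℝ | ∃ u : EuclideanSpace ℝ (Fin n), u ≠ 0 ∧ b = breadth K C u}

/-- The circumradius `R(K, C) = inf {ρ > 0 : K ⊆ t + ρ C for some t}`. -/
def circumradius {n : ℕ} (K C : Set (EuclideanSpace ℝ (Fin n))) : ℝ :=
  sInf {ρ : ℝ | 0 < ρ ∧ ∃ t : EuclideanSpace ℝ (Fin n), K ⊆ t +ᵥ (ρ • C)}

/-- The inradius `r(K, C) = sup {ρ > 0 : t + ρ C ⊆ K for some t}`. -/
def inradius {n : ℕ} (K C : Set (EuclideanSpace ℝ (Fin n))) : ℝ :=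
  sSup {ρ : ℝ | 0 < ρ ∧ ∃ t : EuclideanSpace ℝ (Fin n), t +ᵥ (ρ • C) ⊆ K}

/-- `K` is a body that is pseudo-complete with respect to `C`: `r(K, C) + R(K, C) = D(K, C)`. -/
def IsPseudoComplete {n : ℕ} (K C : Set (EuclideanSpace ℝ (Fin n))) : Prop :=
  IsBody K ∧ inradius K C + circumradius K C = diameter K C

/-- The Euclidean unit disk. -/
def unitDisk : Set (EuclideanSpace ℝ (Fin 2)) := Metric.closedBall 0 1

/-- The constant `t = ∛(32/9) (∛(9 + √69) + ∛(9 - √69))`; all radicands are positive. -/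
def tConst : ℝ :=
  (32 / 9 : ℝ) ^ (1 / 3 : ℝ) *
    ((9 + √69) ^ (1 / 3 : ℝ) + (9 - √69) ^ (1 / 3 : ℝ))

/-- The constant `r = (√t + √(16 / √t - t)) / 2 - 1`. -/
def rConst : ℝ := (√tConst + √(16 / √tConst - tConst)) / 2 - 1

/-- The hood: the convex hull of the three points `(0, 1)`, `(± r, -√(1 - r²))` of the unit circle
and the disk of radius `r` centred at the origin. -/
def hood : Set (EuclideanSpace ℝ (Fin 2)) :=
  convexHull ℝ
    ({!₂[0, 1], !₂[rConst, -√(1 - rConst ^ 2)], !₂[-rConst, -√(1 - rConst ^ 2)]} ∪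
      rConst • unitDisk)

/-- A hood: any set similar to the hood just defined, that is, a dilate of an isometric copy. -/
def IsHood (K : Set (EuclideanSpace ℝ (Fin 2))) : Prop :=
  ∃ (c : ℝ) (e : EuclideanSpace ℝ (Fin 2) ≃ᵢ EuclideanSpace ℝ (Fin 2)), 0 < c ∧ K = c • (e '' hood)

end MinkowskiGeom

end

/-!
Scale `K` to circumradius `1`. Pseudo-completeness makes the incircle, of radius `ρ`, concentric
with the circumcircle, say around `0`, and the diameter of `K` is `1 + ρ`. The points where `K`
touches the circumcircle include three unit vectors (possibly with repetitions) having `0` as a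
convex combination. Their mutual distances are at most `1 + ρ`, so their inner products are at least
`-m`, where `(1 + ρ) ^ 2 = 2 * (1 + m)`; this bounds the weights of the combination by
`m / (1 + m)`, and so the inner product of two different ones by `2 * m ^ 2 - 1`.

If `K` lies in the strip `-H₂ ≤ ⟪u, ·⟫ ≤ H₁`, where `‖u‖ = 1`, then two of the three vectors are on
the same side of the line `ℝ u`, and a pair of such vectors that far apart fits into the strip only
if `4 * (1 - m ^ 2) * (m ^ 2 + H₁ * H₂) ≤ (H₁ + H₂) ^ 2`. Since `H₁, H₂ ≥ ρ`, this gives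
`2 * r ≤ H₁ + H₂` as long as `ρ < r`, where `r` is the solution of
`r ^ 2 + ((1 + r) ^ 2 / 2 - 1) ^ 2 = 1`. For `ρ ≥ r` the trivial bound `2 * ρ ≤ w` is enough.

The equation for `r` says that in the hood the feet are at distance exactly `1 + r` from the apex.
-/

namespace MinkowskiGeom

open Metric Set Filter Topology Module

section ConvexHull

variable {E : Type*} [AddCommGroup E] [Module ℝ E] [FiniteDimensional ℝ E]

theorem exists_fin_stdSimplex_of_mem_convexHull {s : Set E} {x : E} (hx : x ∈ convexHull ℝ s)
    {k : ℕ} (hk : finrank ℝ E < k) :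
    ∃ (w : Fin k → ℝ) (z : Fin k → E),
      w ∈ stdSimplex ℝ (Fin k) ∧ (∀ i, z i ∈ s) ∧ ∑ i, w i • z i = x := by
  obtain ⟨ι, _, z, w, hzs, hind, hw, hw1, hwz⟩ := eq_pos_convex_span_of_mem_convexHull hx
  have hcard : Fintype.card ι ≤ Fintype.card (Fin k) := by
    rw [Fintype.card_fin]
    exact hind.card_le_finrank_succ.trans
      ((Nat.succ_le_succ (Submodule.finrank_le _)).trans hk)
  obtain ⟨e⟩ := Function.Embedding.nonempty_of_card_le hcard
  obtain ⟨p, hp⟩ : s.Nonempty := convexHull_nonempty_iff.1 ⟨x, hx⟩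
  have hw_range (i : ι) : Function.extend e w (fun _ => 0) (e i) = w i :=
    e.injective.extend_apply w _ i
  have hz_range (i : ι) : Function.extend e z (fun _ => p) (e i) = z i :=
    e.injective.extend_apply z _ i
  have hw_compl (j : Fin k) (hj : j ∉ range e) : Function.extend e w (fun _ => 0) j = 0 :=
    Function.extend_apply' w _ j hj
  refine ⟨Function.extend e w fun _ => 0, Function.extend e z fun _ => p, ⟨fun j => ?_, ?_⟩,
    fun j => ?_, ?_⟩
  · by_cases hj : j ∈ range e
    · obtain ⟨i, rfl⟩ := hj
      exact (hw i).le.trans_eq (hw_range i).symm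
    · exact (hw_compl j hj).ge
  · rw [← hw1]
    exact (Fintype.sum_of_injective e e.injective _ _ hw_compl fun i => (hw_range i).symm).symm
  · by_cases hj : j ∈ range e
    · obtain ⟨i, rfl⟩ := hj
      rw [hz_range]
      exact hzs ⟨i, rfl⟩
    · rwa [Function.extend_apply' _ _ _ hj]
  · rw [← hwz]
    refine (Fintype.sum_of_injective e e.injective _ _ (fun j hj => ?_) fun i => ?_).symm
    · rw [hw_compl j hj, zero_smul]
    · rw [hw_range, hz_range]

theorem isCompact_convexHull [TopologicalSpace E] [ContinuousAdd E] [ContinuousSMul ℝ E]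
    {s : Set E} (hs : IsCompact s) : IsCompact (convexHull ℝ s) := by
  let k := finrank ℝ E + 1
  have himage : convexHull ℝ s = (fun y : (Fin k → ℝ) × (Fin k → E) => ∑ i, y.1 i • y.2 i) ''
      (stdSimplex ℝ (Fin k) ×ˢ univ.pi fun _ => s) := by
    refine Subset.antisymm (fun x hx => ?_) ?_
    · obtain ⟨w, z, hw, hz, hwz⟩ :=
        exists_fin_stdSimplex_of_mem_convexHull hx (Nat.lt_succ_self (finrank ℝ E))
      exact ⟨(w, z), ⟨hw, fun i _ => hz i⟩, hwz⟩
    · rintro _ ⟨⟨w, z⟩, ⟨hw, hz⟩, rfl⟩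
      exact (convex_convexHull ℝ s).sum_mem (fun i _ => hw.1 i) hw.2
        fun i _ => subset_convexHull ℝ s (hz i trivial)
  rw [himage]
  exact ((isCompact_stdSimplex ℝ (Fin k)).prod (isCompact_univ_pi fun _ => hs)).image (by fun_prop)

end ConvexHull

section EnclosingBall

variable {E : Type*} [NormedAddCommGroup E] [InnerProductSpace ℝ E]

theorem exists_le_dist_of_mem_convexHull {P : Set E} {c : E} {R : ℝ} (hP : P ⊆ sphere c R)
    (hc : c ∈ convexHull ℝ P) (t : E) : ∃ x ∈ P, R ≤ dist x t := by
  by_contra! hlt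
  have hP_halfSpace : P ⊆ {x | inner ℝ (t - c) c < inner ℝ (t - c) x} := by
    intro x hx
    have hsq : dist x t ^ 2 < R ^ 2 := by
      gcongr
      exact hlt x hx
    rw [dist_eq_norm, ← sub_sub_sub_cancel_right x t c, norm_sub_sq_real,
      mem_sphere_iff_norm.1 (hP hx), real_inner_comm, inner_sub_right] at hsq
    change inner ℝ (t - c) c < inner ℝ (t - c) x
    linarith [sq_nonneg ‖t - c‖]
  have hc_halfSpace : inner ℝ (t - c) c < inner ℝ (t - c) c :=
    convexHull_min hP_halfSpace (convex_halfSpace_gt (innerₛₗ ℝ (t - c)).isLinear _) hc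
  exact hc_halfSpace.false

theorem center_mem_convexHull_inter_sphere [FiniteDimensional ℝ E] {K : Set E} (hK : IsCompact K)
    {c : E} {R : ℝ} (hKR : K ⊆ closedBall c R) (hR : ∀ t, ∃ x ∈ K, R ≤ dist x t) :
    c ∈ convexHull ℝ (K ∩ sphere c R) := by
  by_contra hc
  obtain ⟨f, a, hfc, hf⟩ := geometric_hahn_banach_point_closed (convex_convexHull ℝ _)
    (isCompact_convexHull (hK.inter_right isClosed_sphere)).isClosed hc
  obtain ⟨v, rfl⟩ := (InnerProductSpace.toDual ℝ E).surjective f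
  -- Shifting the centre by `ε • v` moves it towards all contact points. If no such shift allows a
  -- smaller radius, the points obstructing it accumulate at a contact point where `⟪v, · - c⟫ ≤ 0`.
  let ε (n : ℕ) : ℝ := 1 / (n + 1)
  have hε (n : ℕ) : 0 < ε n := Nat.one_div_pos_of_nat
  choose x hxK hxR using fun n => hR (c + ε n • v)
  obtain ⟨y, hyK, φ, hφ, hy⟩ := hK.tendsto_subseq hxK
  have hε_lim : Tendsto (ε ∘ φ) atTop (𝓝 0) :=
    tendsto_one_div_add_atTop_nhds_zero_nat.comp hφ.tendsto_atTop
  have hinner (n : ℕ) : 2 * inner ℝ v (x n - c) ≤ ε n * ‖v‖ ^ 2 := by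
    have hfar : R ^ 2 ≤ ‖x n - c - ε n • v‖ ^ 2 := by
      rw [sub_sub, ← dist_eq_norm]
      have hR0 : 0 ≤ R := dist_nonneg.trans (hKR (hxK n))
      gcongr
      exact hxR n
    have hnear : ‖x n - c‖ ^ 2 ≤ R ^ 2 := by
      gcongr
      exact mem_closedBall_iff_norm.1 (hKR (hxK n))
    rw [norm_sub_sq_real, inner_smul_right, real_inner_comm, norm_smul, mul_pow, Real.norm_eq_abs,
      sq_abs] at hfar
    refine le_of_mul_le_mul_left ?_ (hε n)
    linarith
  have hy_inner : 2 * inner ℝ v (y - c) ≤ 0 * ‖v‖ ^ 2 :=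
    le_of_tendsto_of_tendsto' (((tendsto_const_nhds.inner (hy.sub_const c))).const_mul 2)
      (hε_lim.mul_const _) fun n => hinner (φ n)
  have hy_dist : R ≤ dist y (c + (0 : ℝ) • v) :=
    ge_of_tendsto' (hy.dist (tendsto_const_nhds.add (hε_lim.smul_const v))) fun n => hxR (φ n)
  rw [zero_smul, add_zero] at hy_dist
  have hy_contact := hf y (subset_convexHull ℝ _ ⟨hyK, le_antisymm (hKR hyK) hy_dist⟩)
  rw [InnerProductSpace.toDual_apply_apply] at hfc hy_contact
  rw [inner_sub_right] at hy_inner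
  linarith

end EnclosingBall

section NormedSpace

variable {E : Type*} [NormedAddCommGroup E] [NormedSpace ℝ E] [Nontrivial E]

theorem exists_norm_eq_one_norm_smul_eq (v : E) : ∃ e : E, ‖e‖ = 1 ∧ ‖v‖ • e = v := by
  rcases eq_or_ne v 0 with rfl | hv
  · obtain ⟨e, he⟩ := exists_norm_eq E zero_le_one
    exact ⟨e, he, by simp⟩
  · exact ⟨‖v‖⁻¹ • v, norm_smul_inv_norm hv, smul_inv_smul₀ (norm_ne_zero_iff.2 hv) v⟩

theorem subset_closedBall_diam_sub {K : Set E} (hK : Bornology.IsBounded K) {c : E} {r : ℝ}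
    (hr : 0 ≤ r) (hcK : closedBall c r ⊆ K) : K ⊆ closedBall c (diam K - r) := by
  intro x hx
  obtain ⟨e, he, hxc⟩ := exists_norm_eq_one_norm_smul_eq (x - c)
  have hantipode : c - r • e ∈ K := hcK <| by
    rw [mem_closedBall_iff_norm, sub_sub_cancel_left, norm_neg, norm_smul, he, mul_one,
      Real.norm_of_nonneg hr]
  have hdist : dist x (c - r • e) = ‖x - c‖ + r := by
    rw [dist_eq_norm, sub_sub_eq_add_sub, add_sub_right_comm, ← hxc, ← add_smul, norm_smul, he,
      mul_one, Real.norm_of_nonneg (by positivity), hxc]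
  rw [mem_closedBall_iff_norm]
  linarith [dist_le_diam_of_mem hK hx hantipode]

end NormedSpace

section EuclideanBall

variable {n : ℕ} {K : Set (EuclideanSpace ℝ (Fin n))} {c u : EuclideanSpace ℝ (Fin n)} {r R b : ℝ}

theorem sSup_inner_closedBall (u : EuclideanSpace ℝ (Fin n)) :
    sSup {a : ℝ | ∃ x ∈ closedBall 0 1, a = inner ℝ u x} = ‖u‖ := by
  refine IsGreatest.csSup_eq ⟨⟨‖u‖⁻¹ • u, ?_, ?_⟩, ?_⟩
  · rw [mem_closedBall_zero_iff, norm_smul, norm_inv, norm_norm]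
    exact inv_mul_le_one
  · rw [inner_smul_right, real_inner_self_eq_norm_mul_norm, ← mul_assoc, inv_mul_mul_self]
  · rintro _ ⟨x, hx, rfl⟩
    exact (real_inner_le_norm u x).trans
      (mul_le_of_le_one_right (norm_nonneg u) (mem_closedBall_zero_iff.1 hx))

theorem breadth_nonneg : 0 ≤ breadth K (closedBall 0 1) u := by
  rw [breadth, sSup_inner_closedBall]
  refine div_nonneg ?_ (norm_nonneg u)
  rcases K.eq_empty_or_nonempty with rfl | ⟨x, hx⟩
  · simp
  · exact Real.sSup_nonneg' ⟨0, ⟨x, hx, x, hx, by simp⟩, le_rfl⟩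

theorem breadth_le (hb : 0 ≤ b) (h : ∀ x ∈ K, ∀ y ∈ K, inner ℝ u (x - y) ≤ b * ‖u‖) :
    breadth K (closedBall 0 1) u ≤ b := by
  rw [breadth, sSup_inner_closedBall]
  refine div_le_of_le_mul₀ (norm_nonneg u) hb (Real.sSup_le ?_ (by positivity))
  rintro _ ⟨x, hx, y, hy, rfl⟩
  exact h x hx y hy

theorem inner_sub_le_breadth_mul_norm (hK : Bornology.IsBounded K)
    (u : EuclideanSpace ℝ (Fin n)) {x y : EuclideanSpace ℝ (Fin n)} (hx : x ∈ K) (hy : y ∈ K) :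
    inner ℝ u (x - y) ≤ breadth K (closedBall 0 1) u * ‖u‖ := by
  rcases eq_or_ne u 0 with rfl | hu
  · simp
  rw [breadth, sSup_inner_closedBall, div_mul_cancel₀ _ (norm_ne_zero_iff.2 hu)]
  refine le_csSup ⟨‖u‖ * diam K, ?_⟩ ⟨x, hx, y, hy, rfl⟩
  rintro _ ⟨x, hx, y, hy, rfl⟩
  refine (real_inner_le_norm u _).trans ?_
  gcongr
  exact dist_eq_norm x y ▸ dist_le_diam_of_mem hK hx hy

theorem breadth_le_diam (hK : Bornology.IsBounded K) :
    breadth K (closedBall 0 1) u ≤ diam K := by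
  refine breadth_le diam_nonneg fun x hx y hy => ?_
  refine (real_inner_le_norm u _).trans ?_
  rw [mul_comm]
  gcongr
  exact dist_eq_norm x y ▸ dist_le_diam_of_mem hK hx hy

theorem diameter_eq_diam (hK : Bornology.IsBounded K) :
    diameter K (closedBall 0 1) = diam K := by
  apply le_antisymm
  · refine Real.sSup_le ?_ diam_nonneg
    rintro _ ⟨u, -, rfl⟩
    exact breadth_le_diam hK
  · have hnonneg : 0 ≤ diameter K (closedBall 0 1) := by
      refine Real.sSup_nonneg ?_
      rintro _ ⟨u, -, rfl⟩
      exact breadth_nonneg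
    refine diam_le_of_forall_dist_le hnonneg fun x hx y hy => ?_
    rcases eq_or_ne x y with rfl | hxy
    · rwa [dist_self]
    have hbreadth : dist x y ≤ breadth K (closedBall 0 1) (x - y) := by
      have hinner := inner_sub_le_breadth_mul_norm hK (x - y) hx hy
      rw [real_inner_self_eq_norm_mul_norm] at hinner
      rw [dist_eq_norm]
      exact le_of_mul_le_mul_right hinner (norm_pos_iff.2 (sub_ne_zero.2 hxy))
    refine hbreadth.trans (le_csSup ⟨diam K, ?_⟩ ⟨x - y, sub_ne_zero.2 hxy, rfl⟩)
    rintro _ ⟨u, -, rfl⟩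
    exact breadth_le_diam hK

theorem two_mul_le_breadth (hK : Bornology.IsBounded K) (hr : 0 ≤ r) (hcK : closedBall c r ⊆ K)
    (hu : u ≠ 0) : 2 * r ≤ breadth K (closedBall 0 1) u := by
  have := nontrivial_of_ne u 0 hu
  obtain ⟨e, he, heu⟩ := exists_norm_eq_one_norm_smul_eq u
  have hre : ‖r • e‖ = r := by rw [norm_smul, he, mul_one, Real.norm_of_nonneg hr]
  have hright : c + r • e ∈ K := hcK (by rw [mem_closedBall_iff_norm, add_sub_cancel_left, hre])
  have hleft : c - r • e ∈ K := hcK (by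
    rw [mem_closedBall_iff_norm, sub_sub_cancel_left, norm_neg, hre])
  refine le_of_mul_le_mul_right ?_ (norm_pos_iff.2 hu)
  calc 2 * r * ‖u‖ = inner ℝ u (c + r • e - (c - r • e)) := by
        rw [add_sub_sub_cancel, ← two_smul ℝ, smul_smul, inner_smul_right]
        nth_rw 2 [← heu]
        rw [real_inner_smul_left, real_inner_self_eq_norm_sq, he]
        ring
    _ ≤ breadth K (closedBall 0 1) u * ‖u‖ := inner_sub_le_breadth_mul_norm hK u hright hleft

theorem width_le_breadth (hu : u ≠ 0) :
    width K (closedBall 0 1) ≤ breadth K (closedBall 0 1) u := by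
  refine csInf_le ⟨0, ?_⟩ ⟨u, hu, rfl⟩
  rintro _ ⟨v, -, rfl⟩
  exact breadth_nonneg

theorem le_circumradius (hK : Bornology.IsBounded K) (h : ∀ t, ∃ x ∈ K, R ≤ dist x t) :
    R ≤ circumradius K (closedBall 0 1) := by
  obtain ⟨ρ, hρ, hKρ⟩ := hK.subset_closedBall_lt 0 0
  refine le_csInf ⟨ρ, hρ, 0, by rwa [affinity_unitClosedBall hρ.le]⟩ ?_
  rintro σ ⟨hσ, t, ht⟩
  rw [affinity_unitClosedBall hσ.le] at ht
  obtain ⟨x, hx, hxt⟩ := h t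
  exact hxt.trans (ht hx)

theorem circumradius_le (hR : 0 ≤ R) (hKc : K ⊆ closedBall c R) :
    circumradius K (closedBall 0 1) ≤ R := by
  refine le_of_forall_pos_le_add fun ε hε => csInf_le ⟨0, fun ρ hρ => hρ.1.le⟩
    ⟨by positivity, c, ?_⟩
  rw [affinity_unitClosedBall (by positivity)]
  exact hKc.trans (closedBall_subset_closedBall (by linarith))

theorem exists_circumradius_le_dist (hK : IsCompact K) (hne : K.Nonempty)
    (t : EuclideanSpace ℝ (Fin n)) : ∃ x ∈ K, circumradius K (closedBall 0 1) ≤ dist x t := by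
  obtain ⟨x, hx, hmax⟩ := hK.exists_isMaxOn hne (f := fun x => dist x t) (by fun_prop)
  exact ⟨x, hx, circumradius_le dist_nonneg fun y hy => hmax hy⟩

theorem inradius_nonneg : 0 ≤ inradius K (closedBall 0 1) :=
  Real.sSup_nonneg fun _ hρ => hρ.1.le

variable [NeZero n]

theorem le_width (h : ∀ u, u ≠ 0 → b ≤ breadth K (closedBall 0 1) u) :
    b ≤ width K (closedBall 0 1) := by
  obtain ⟨v, hv⟩ := exists_ne (0 : EuclideanSpace ℝ (Fin n))
  refine le_csInf ⟨_, v, hv, rfl⟩ ?_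
  rintro _ ⟨u, hu, rfl⟩
  exact h u hu

theorem le_inradius (hK : Bornology.IsBounded K) (hcK : closedBall c r ⊆ K) :
    r ≤ inradius K (closedBall 0 1) := by
  rcases le_or_gt r 0 with hr | hr
  · exact hr.trans inradius_nonneg
  refine le_csSup ⟨diam K, ?_⟩ ⟨hr, c, by rwa [affinity_unitClosedBall hr.le]⟩
  rintro ρ ⟨hρ, t, ht⟩
  rw [affinity_unitClosedBall hρ.le] at ht
  obtain ⟨v, hv⟩ := exists_norm_eq (EuclideanSpace ℝ (Fin n)) hρ.le
  have hdist := dist_le_diam_of_mem hK (x := t + v) (y := t)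
    (ht (by rw [mem_closedBall_iff_norm, add_sub_cancel_left, hv]))
    (ht (mem_closedBall_self hρ.le))
  rwa [dist_eq_norm, add_sub_cancel_left, hv] at hdist

theorem exists_closedBall_inradius_subset (hK : IsCompact K) (hne : K.Nonempty) :
    ∃ c, closedBall c (inradius K (closedBall 0 1)) ⊆ K := by
  obtain ⟨c, hc, hmax⟩ := hK.exists_isMaxOn hne (f := fun x => infDist x Kᶜ)
    (continuous_infDist_pt _).continuousOn
  have hle : inradius K (closedBall 0 1) ≤ infDist c Kᶜ := by
    refine Real.sSup_le ?_ infDist_nonneg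
    rintro ρ ⟨hρ, t, ht⟩
    rw [affinity_unitClosedBall hρ.le] at ht
    refine le_trans ?_ (hmax (ht (mem_closedBall_self hρ.le)))
    refine (le_infDist (nonempty_compl.2 hK.ne_univ)).2 fun y hy => ?_
    rw [dist_comm]
    exact (not_le.1 fun hyt => hy (ht hyt)).le
  exact ⟨c, (closedBall_subset_closedBall hle).trans
    ((closedBall_infDist_compl_subset_closure hc).trans_eq hK.isClosed.closure_eq)⟩

theorem IsBody.inradius_pos (hK : IsBody K) : 0 < inradius K (closedBall 0 1) := by
  obtain ⟨x, hx⟩ := hK.2.2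
  obtain ⟨ε, hε, hxε⟩ := nhds_basis_closedBall.mem_iff.1 (mem_interior_iff_mem_nhds.1 hx)
  exact hε.trans_le (le_inradius hK.2.1.isBounded hxε)

theorem exists_concentric_closedBall (hK : IsCompact K) (hne : K.Nonempty) :
    ∃ c, closedBall c (inradius K (closedBall 0 1)) ⊆ K ∧
      K ⊆ closedBall c (diameter K (closedBall 0 1) - inradius K (closedBall 0 1)) := by
  obtain ⟨c, hc⟩ := exists_closedBall_inradius_subset hK hne
  rw [diameter_eq_diam hK.isBounded]
  exact ⟨c, hc, subset_closedBall_diam_sub hK.isBounded inradius_nonneg hc⟩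

theorem inradius_add_circumradius_le_diameter (hK : IsCompact K) (hne : K.Nonempty) :
    inradius K (closedBall 0 1) + circumradius K (closedBall 0 1) ≤
      diameter K (closedBall 0 1) := by
  obtain ⟨c, -, hc⟩ := exists_concentric_closedBall hK hne
  obtain ⟨x, hx⟩ := hne
  linarith [circumradius_le (dist_nonneg.trans (hc hx)) hc]

end EuclideanBall

section Similarity

variable {n : ℕ} {K : Set (EuclideanSpace ℝ (Fin n))} {c : ℝ}

theorem exists_linearIsometryEquiv_sub (e : EuclideanSpace ℝ (Fin n) ≃ᵢ EuclideanSpace ℝ (Fin n)) :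
    ∃ L : EuclideanSpace ℝ (Fin n) ≃ₗᵢ[ℝ] EuclideanSpace ℝ (Fin n),
      ∀ x y, e x - e y = L (x - y) :=
  ⟨e.toRealAffineIsometryEquiv.linearIsometryEquiv, fun x y =>
    (e.toRealAffineIsometryEquiv.map_vsub x y).symm⟩

theorem surjective_smul_isometryEquiv (hc : c ≠ 0)
    (e : EuclideanSpace ℝ (Fin n) ≃ᵢ EuclideanSpace ℝ (Fin n)) :
    Function.Surjective fun x => c • e x :=
  (MulAction.surjective₀ hc).comp e.surjective

theorem vadd_mul_smul_closedBall (hc : 0 < c) {ρ : ℝ} (hρ : 0 < ρ)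
    (e : EuclideanSpace ℝ (Fin n) ≃ᵢ EuclideanSpace ℝ (Fin n)) (t : EuclideanSpace ℝ (Fin n)) :
    (c • e t) +ᵥ (c * ρ) • closedBall (0 : EuclideanSpace ℝ (Fin n)) 1 =
      c • (e '' (t +ᵥ ρ • closedBall (0 : EuclideanSpace ℝ (Fin n)) 1)) := by
  rw [affinity_unitClosedBall (by positivity), affinity_unitClosedBall hρ.le, e.image_closedBall,
    smul_closedBall' hc.ne', Real.norm_of_nonneg hc.le]

theorem inradius_smul_image (hc : 0 < c)
    (e : EuclideanSpace ℝ (Fin n) ≃ᵢ EuclideanSpace ℝ (Fin n)) :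
    inradius (c • (e '' K)) (closedBall 0 1) = c * inradius K (closedBall 0 1) := by
  rw [inradius, inradius, ← smul_eq_mul, ← Real.sSup_smul_of_nonneg hc.le]
  congr 1
  ext ρ
  obtain ⟨ρ, rfl⟩ : ∃ a, c • a = ρ := MulAction.surjective₀ hc.ne' ρ
  rw [smul_mem_smul_set_iff₀ hc.ne', mem_ofPred_eq, mem_ofPred_eq, smul_eq_mul,
    mul_pos_iff_of_pos_left hc, (surjective_smul_isometryEquiv hc.ne' e).exists]
  refine and_congr_right fun hρ => exists_congr fun t => ?_
  rw [vadd_mul_smul_closedBall hc hρ, smul_set_subset_smul_set_iff₀ hc.ne',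
    image_subset_image_iff e.injective]

theorem circumradius_smul_image (hc : 0 < c)
    (e : EuclideanSpace ℝ (Fin n) ≃ᵢ EuclideanSpace ℝ (Fin n)) :
    circumradius (c • (e '' K)) (closedBall 0 1) = c * circumradius K (closedBall 0 1) := by
  rw [circumradius, circumradius, ← smul_eq_mul, ← Real.sInf_smul_of_nonneg hc.le]
  congr 1
  ext ρ
  obtain ⟨ρ, rfl⟩ : ∃ a, c • a = ρ := MulAction.surjective₀ hc.ne' ρ
  rw [smul_mem_smul_set_iff₀ hc.ne', mem_ofPred_eq, mem_ofPred_eq, smul_eq_mul,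
    mul_pos_iff_of_pos_left hc, (surjective_smul_isometryEquiv hc.ne' e).exists]
  refine and_congr_right fun hρ => exists_congr fun t => ?_
  rw [vadd_mul_smul_closedBall hc hρ, smul_set_subset_smul_set_iff₀ hc.ne',
    image_subset_image_iff e.injective]

theorem breadth_smul_image (hc : 0 < c)
    {e : EuclideanSpace ℝ (Fin n) ≃ᵢ EuclideanSpace ℝ (Fin n)}
    {L : EuclideanSpace ℝ (Fin n) ≃ₗᵢ[ℝ] EuclideanSpace ℝ (Fin n)}
    (hL : ∀ x y, e x - e y = L (x - y)) (u : EuclideanSpace ℝ (Fin n)) :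
    breadth (c • (e '' K)) (closedBall 0 1) (L u) = c * breadth K (closedBall 0 1) u := by
  rw [breadth, breadth, sSup_inner_closedBall, sSup_inner_closedBall, L.norm_map, ← mul_div_assoc,
    ← smul_eq_mul, ← Real.sSup_smul_of_nonneg hc.le]
  congr 2
  ext a
  simp only [mem_ofPred_eq, ← image_smul, exists_mem_image, ← smul_sub, hL, inner_smul_right,
    L.inner_map_map]
  constructor
  · rintro ⟨x, hx, y, hy, rfl⟩
    exact ⟨_, ⟨x, hx, y, hy, rfl⟩, rfl⟩
  · rintro ⟨_, ⟨x, hx, y, hy, rfl⟩, rfl⟩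
    exact ⟨x, hx, y, hy, rfl⟩

theorem setOf_breadth_smul_image (hc : 0 < c)
    (e : EuclideanSpace ℝ (Fin n) ≃ᵢ EuclideanSpace ℝ (Fin n)) :
    {b : ℝ | ∃ u : EuclideanSpace ℝ (Fin n),
        u ≠ 0 ∧ b = breadth (c • (e '' K)) (closedBall 0 1) u} =
      c • {b : ℝ | ∃ u : EuclideanSpace ℝ (Fin n),
        u ≠ 0 ∧ b = breadth K (closedBall 0 1) u} := by
  obtain ⟨L, hL⟩ := exists_linearIsometryEquiv_sub e
  ext b
  obtain ⟨b, rfl⟩ : ∃ a, c • a = b := MulAction.surjective₀ hc.ne' b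
  rw [smul_mem_smul_set_iff₀ hc.ne', mem_ofPred_eq, mem_ofPred_eq, L.surjective.exists]
  refine exists_congr fun u => and_congr (map_ne_zero_iff L L.injective) ?_
  rw [breadth_smul_image hc hL, smul_eq_mul, mul_right_inj' hc.ne']

theorem width_smul_image (hc : 0 < c)
    (e : EuclideanSpace ℝ (Fin n) ≃ᵢ EuclideanSpace ℝ (Fin n)) :
    width (c • (e '' K)) (closedBall 0 1) = c * width K (closedBall 0 1) := by
  rw [width, setOf_breadth_smul_image hc, Real.sInf_smul_of_nonneg hc.le, smul_eq_mul, width]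

theorem diameter_smul_image (hc : 0 < c)
    (e : EuclideanSpace ℝ (Fin n) ≃ᵢ EuclideanSpace ℝ (Fin n)) :
    diameter (c • (e '' K)) (closedBall 0 1) = c * diameter K (closedBall 0 1) := by
  rw [diameter, setOf_breadth_smul_image hc, Real.sSup_smul_of_nonneg hc.le, smul_eq_mul, diameter]

theorem diameter_div_width_smul_image (hc : 0 < c)
    (e : EuclideanSpace ℝ (Fin n) ≃ᵢ EuclideanSpace ℝ (Fin n)) :
    diameter (c • (e '' K)) (closedBall 0 1) / width (c • (e '' K)) (closedBall 0 1) =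
      diameter K (closedBall 0 1) / width K (closedBall 0 1) := by
  rw [diameter_smul_image hc, width_smul_image hc, mul_div_mul_left _ _ hc.ne']

theorem IsBody.smul_image (hK : IsBody K) (hc : c ≠ 0)
    (e : EuclideanSpace ℝ (Fin n) ≃ᵢ EuclideanSpace ℝ (Fin n)) : IsBody (c • (e '' K)) := by
  obtain ⟨hconv, hcomp, hint⟩ := hK
  refine ⟨Convex.smul ?_ c, (hcomp.image e.continuous).smul c, ?_⟩
  · exact hconv.affine_image e.toRealAffineIsometryEquiv.toAffineEquiv.toAffineMap
  · rw [interior_smul₀ hc, ← e.coe_toHomeomorph, ← e.toHomeomorph.image_interior]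
    exact (hint.image _).smul_set

theorem IsPseudoComplete.smul_image (hK : IsPseudoComplete K (closedBall 0 1)) (hc : 0 < c)
    (e : EuclideanSpace ℝ (Fin n) ≃ᵢ EuclideanSpace ℝ (Fin n)) :
    IsPseudoComplete (c • (e '' K)) (closedBall 0 1) := by
  refine ⟨hK.1.smul_image hc.ne' e, ?_⟩
  rw [inradius_smul_image hc, circumradius_smul_image hc, diameter_smul_image hc, ← mul_add, hK.2]

end Similarity

section Balanced

variable {ι E : Type*} [Fintype ι] [NormedAddCommGroup E] [InnerProductSpace ℝ E]

/-- Unit vectors `z i` and weights `w i` exhibiting `0` as a convex combination of the `z i`; this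
is how a body touches its minimal enclosing ball when that ball is the unit ball. -/
structure IsBalanced (w : ι → ℝ) (z : ι → E) : Prop where
  mem_stdSimplex : w ∈ stdSimplex ℝ ι
  norm_eq_one (i : ι) : ‖z i‖ = 1
  sum_smul_eq_zero : ∑ i, w i • z i = 0

theorem neg_le_inner_of_dist_le {x y : E} {d m : ℝ} (hx : ‖x‖ = 1) (hy : ‖y‖ = 1)
    (hxy : dist x y ≤ d) (hd : d ^ 2 = 2 * (1 + m)) : -m ≤ inner ℝ x y := by
  have hsq : dist x y ^ 2 ≤ d ^ 2 := by gcongr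
  rw [dist_eq_norm, norm_sub_sq_real, hx, hy, hd] at hsq
  linarith

theorem IsBalanced.weight_mul_le {w : ι → ℝ} {z : ι → E} (hwz : IsBalanced w z) {m : ℝ}
    (hm : ∀ i j, -m ≤ inner ℝ (z i) (z j)) (j : ι) : w j * (1 + m) ≤ m := by
  have hsum : ∑ i, w i * inner ℝ (z j) (z i) = 0 := by
    simp_rw [← real_inner_smul_right, ← inner_sum, hwz.sum_smul_eq_zero, inner_zero_right]
  calc w j * (1 + m) = w j * (inner ℝ (z j) (z j) + m) := by
        rw [real_inner_self_eq_norm_sq, hwz.norm_eq_one, one_pow]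
    _ ≤ ∑ i, w i * (inner ℝ (z j) (z i) + m) :=
        Finset.single_le_sum (f := fun i => w i * (inner ℝ (z j) (z i) + m))
          (fun i _ => mul_nonneg (hwz.mem_stdSimplex.1 i) (by linarith [hm j i]))
          (Finset.mem_univ j)
    _ = m := by
        simp_rw [mul_add, Finset.sum_add_distrib, hsum, ← Finset.sum_mul, hwz.mem_stdSimplex.2]
        ring

theorem IsBalanced.one_add_le_card_mul {w : ι → ℝ} {z : ι → E} (hwz : IsBalanced w z) {m : ℝ}
    (hm : ∀ i j, -m ≤ inner ℝ (z i) (z j)) : 1 + m ≤ Fintype.card ι * m := by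
  calc 1 + m = ∑ j, w j * (1 + m) := by rw [← Finset.sum_mul, hwz.mem_stdSimplex.2, one_mul]
    _ ≤ ∑ _j : ι, m := Finset.sum_le_sum fun j _ => hwz.weight_mul_le hm j
    _ = Fintype.card ι * m := by rw [Finset.sum_const, Finset.card_univ, nsmul_eq_mul]

theorem inner_le_of_norm_smul_add_smul_le {x y : E} {a b m : ℝ} (hx : ‖x‖ = 1) (hy : ‖y‖ = 1)
    (ha : 0 < a) (hb : 0 < b) (h : ‖a • x + b • y‖ ≤ m * (a + b)) :
    inner ℝ x y ≤ 2 * m ^ 2 - 1 := by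
  rcases le_or_gt 1 (m ^ 2) with hm | hm
  · have hle := real_inner_le_norm x y
    rw [hx, hy] at hle
    linarith
  have hsq : ‖a • x + b • y‖ ^ 2 ≤ (m * (a + b)) ^ 2 := by gcongr
  rw [norm_add_sq_real, real_inner_smul_left, real_inner_smul_right, norm_smul, norm_smul, hx, hy,
    Real.norm_of_nonneg ha.le, Real.norm_of_nonneg hb.le] at hsq
  have hdefect : 0 ≤ (1 - m ^ 2) * (a - b) ^ 2 :=
    mul_nonneg (sub_nonneg.2 hm.le) (sq_nonneg _)
  refine le_of_mul_le_mul_left ?_ (mul_pos ha hb)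
  linarith

theorem IsBalanced.inner_le {w : Fin 3 → ℝ} {z : Fin 3 → E} (hwz : IsBalanced w z) {m : ℝ}
    (hm : ∀ i j, -m ≤ inner ℝ (z i) (z j)) {i j : Fin 3} (hij : i ≠ j) :
    inner ℝ (z i) (z j) ≤ 2 * m ^ 2 - 1 := by
  rcases le_or_gt 1 m with hm1 | hm1
  · have hle := real_inner_le_norm (z i) (z j)
    rw [hwz.norm_eq_one, hwz.norm_eq_one] at hle
    nlinarith
  obtain ⟨k, hki, hkj, huniv⟩ : ∃ k, i ∉ ({j, k} : Finset (Fin 3)) ∧ j ∉ ({k} : Finset (Fin 3)) ∧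
      (Finset.univ : Finset (Fin 3)) = {i, j, k} := by
    decide +revert
  have hw := hwz.mem_stdSimplex.2
  have hz := hwz.sum_smul_eq_zero
  rw [huniv, Finset.sum_insert hki, Finset.sum_insert hkj, Finset.sum_singleton] at hw hz
  have hwi := hwz.weight_mul_le hm i
  have hwj := hwz.weight_mul_le hm j
  have hwk := hwz.weight_mul_le hm k
  refine inner_le_of_norm_smul_add_smul_le (hwz.norm_eq_one i) (hwz.norm_eq_one j)
    (a := w i) (b := w j) ?_ ?_ ?_
  · nlinarith
  · nlinarith
  · rw [← add_assoc] at hz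
    rw [eq_neg_of_add_eq_zero_left hz, norm_neg, norm_smul, hwz.norm_eq_one, mul_one,
      Real.norm_of_nonneg (hwz.mem_stdSimplex.1 k)]
    linear_combination hwk - m * hw

end Balanced

section Strip

theorem one_sub_sq_le_of_mem_strip {x y x' y' H₁ H₂ κ : ℝ} (h : x ^ 2 + y ^ 2 = 1)
    (h' : x' ^ 2 + y' ^ 2 = 1) (hx : 0 ≤ x * x') (hκ : x * x' + y * y' ≤ κ) (hκ0 : κ ≤ 0)
    (hy : y ∈ Icc (-H₂) H₁) (hy' : y' ∈ Icc (-H₂) H₁) :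
    1 - κ ^ 2 ≤ H₁ ^ 2 + H₂ ^ 2 + 2 * κ * (H₁ * H₂) := by
  wlog hyy : y' ≤ y generalizing x y x' y'
  · exact this h' h (by linarith) (by linarith) hy' hy (not_le.1 hyy).le
  have hy'0 : y' ≤ 0 := by nlinarith
  have hy0 : 0 ≤ y := by nlinarith
  have hκ1 : κ ^ 2 ≤ 1 := by nlinarith [sq_nonneg (x + x'), sq_nonneg (y + y')]
  rcases le_or_gt 1 (H₂ ^ 2) with hH₂ | hH₂
  · nlinarith [sq_nonneg (H₁ + κ * H₂)]
  have hH : -(y * y') ≤ H₁ * H₂ := by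
    rw [← mul_neg]
    exact mul_le_mul hy.2 (neg_le.1 hy'.1) (neg_nonneg.2 hy'0) (hy0.trans hy.2)
  have hprod : (1 - H₁ ^ 2) * (1 - H₂ ^ 2) ≤ (x * x') ^ 2 := by
    rw [mul_pow]
    apply mul_le_mul <;> nlinarith [hy.1, hy.2, hy'.1, hy'.2]
  have hle : (x * x') ^ 2 ≤ (κ + H₁ * H₂) ^ 2 := by
    gcongr
    linarith
  linarith

theorem IsBalanced.four_mul_le_sq_of_mem_strip {E : Type*} [NormedAddCommGroup E]
    [InnerProductSpace ℝ E] [Fact (finrank ℝ E = 2)] {w : Fin 3 → ℝ} {z : Fin 3 → E}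
    (hwz : IsBalanced w z) {m H₁ H₂ : ℝ} (hm : ∀ i j, -m ≤ inner ℝ (z i) (z j))
    (hm2 : 2 * m ^ 2 ≤ 1) {u : E} (hu : ‖u‖ = 1) (hH : ∀ i, inner ℝ u (z i) ∈ Icc (-H₂) H₁) :
    4 * (1 - m ^ 2) * (m ^ 2 + H₁ * H₂) ≤ (H₁ + H₂) ^ 2 := by
  have := FiniteDimensional.of_fact_finrank_eq_two (K := ℝ) (V := E)
  let o : Orientation ℝ E (Fin 2) := (finBasisOfFinrankEq ℝ E Fact.out).orientation
  let x (i : Fin 3) : ℝ := o.areaForm u (z i)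
  let y (i : Fin 3) : ℝ := inner ℝ u (z i)
  have hinner (i j : Fin 3) : x i * x j + y i * y j = inner ℝ (z i) (z j) := by
    rw [add_comm, o.inner_mul_inner_add_areaForm_mul_areaForm, hu, one_pow, one_mul]
  have hnorm (i : Fin 3) : x i ^ 2 + y i ^ 2 = 1 := by
    rw [sq, sq, hinner, real_inner_self_eq_norm_sq, hwz.norm_eq_one, one_pow]
  obtain ⟨i, j, hij, hside⟩ := Fintype.exists_ne_map_eq_of_card_lt (fun i => 0 ≤ x i) (by simp)
  have hxx : 0 ≤ x i * x j := by
    rcases le_or_gt 0 (x i) with hi | hi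
    · exact mul_nonneg hi (hside.mp hi)
    · exact mul_nonneg_of_nonpos_of_nonpos hi.le (not_le.1 fun hj => hi.not_ge (hside.mpr hj)).le
  have hstrip := one_sub_sq_le_of_mem_strip (hnorm i) (hnorm j) hxx
    ((hinner i j).trans_le (hwz.inner_le hm hij)) (by linarith) (hH i) (hH j)
  linarith

end Strip

section HoodConstant

theorem tConst_pos_and_cubic : 0 < tConst ∧ tConst ^ 3 = 16 * tConst + 64 := by
  have hsq : √69 ^ 2 = (69 : ℝ) := Real.sq_sqrt (by norm_num)
  have hlt : √69 < 9 := by rw [Real.sqrt_lt' (by norm_num)]; norm_num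
  have hsub : 0 < 9 - √69 := sub_pos.2 hlt
  have hcube {x : ℝ} (hx : 0 ≤ x) : (x ^ (1 / 3 : ℝ)) ^ 3 = x := by
    rw [one_div]
    exact_mod_cast Real.rpow_inv_natCast_pow hx three_ne_zero
  rw [tConst]
  have hk := hcube (x := 32 / 9) (by norm_num)
  have ha := hcube (x := 9 + √69) (by positivity)
  have hb := hcube hsub.le
  have hk0 : 0 < (32 / 9 : ℝ) ^ (1 / 3 : ℝ) := by positivity
  have ha0 : 0 < (9 + √69) ^ (1 / 3 : ℝ) := by positivity
  have hb0 : 0 < (9 - √69) ^ (1 / 3 : ℝ) := by positivity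
  generalize (32 / 9 : ℝ) ^ (1 / 3 : ℝ) = k at *
  generalize (9 + √69) ^ (1 / 3 : ℝ) = a at *
  generalize (9 - √69) ^ (1 / 3 : ℝ) = b at *
  have hprod : k ^ 2 * a * b = 16 / 3 := by
    refine (pow_left_inj₀ (by positivity) (by norm_num) three_ne_zero).1 ?_
    calc (k ^ 2 * a * b) ^ 3 = (k ^ 3) ^ 2 * (a ^ 3 * b ^ 3) := by ring
      _ = (32 / 9) ^ 2 * (81 - √69 ^ 2) := by rw [hk, ha, hb]; ring
      _ = (16 / 3) ^ 3 := by rw [hsq]; norm_num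
  refine ⟨by positivity, ?_⟩
  calc (k * (a + b)) ^ 3
      = k ^ 3 * (a ^ 3 + b ^ 3) + 3 * (k ^ 2 * a * b) * (k * (a + b)) := by ring
    _ = 16 * (k * (a + b)) + 64 := by rw [hk, ha, hb, hprod]; ring

/-- Ferrari's resolution of a depressed quartic: `s ^ 2` is a root of the resolvent cubic. -/
theorem ferrari_quartic {s D : ℝ} (hs : s ≠ 0) (hcubic : s ^ 6 = 16 * s ^ 2 + 64)
    (hD : (2 * D - s) ^ 2 = 16 / s - s ^ 2) : D ^ 4 - 8 * D + 4 = 0 := by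
  have hfactor : D ^ 2 - s * D + s ^ 2 / 2 - 4 / s = 0 := by
    linear_combination hD / 4
  have hresolvent : s ^ 4 / 4 - 16 / s ^ 2 = 4 := by
    field_simp
    linear_combination hcubic
  calc D ^ 4 - 8 * D + 4
      = D ^ 4 - 8 * D + (s ^ 4 / 4 - 16 / s ^ 2) := by rw [hresolvent]
    _ = (D ^ 2 - s * D + s ^ 2 / 2 - 4 / s) * (D ^ 2 + s * D + s ^ 2 / 2 + 4 / s) := by
        field_simp
        ring
    _ = 0 := by rw [hfactor, zero_mul]

theorem rConst_pos_and_quartic :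
    0 < rConst ∧ (1 + rConst) ^ 4 - 8 * (1 + rConst) + 4 = 0 := by
  obtain ⟨ht0, ht⟩ := tConst_pos_and_cubic
  have ht4 : 4 < tConst := by
    by_contra! h
    nlinarith [mul_pos ht0 ht0]
  have ht12 : tConst ≤ 12 := by
    by_contra! h
    nlinarith [mul_pos ht0 ht0]
  have hs2 : √tConst ^ 2 = tConst := Real.sq_sqrt ht0.le
  have hs : 2 < √tConst := by
    rw [Real.lt_sqrt two_pos.le]
    linarith
  have hrad : 0 ≤ 16 / √tConst - tConst := by
    rw [sub_nonneg, le_div_iff₀ (two_pos.trans hs)]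
    refine (sq_le_sq₀ (by positivity) (by norm_num)).1 ?_
    rw [mul_pow, hs2]
    linarith
  constructor
  · rw [rConst]
    linarith [Real.sqrt_nonneg (16 / √tConst - tConst)]
  · refine ferrari_quartic (s := √tConst) (by positivity) ?_ ?_
    · rw [show √tConst ^ 6 = (√tConst ^ 2) ^ 3 by ring, hs2, ht]
    · rw [show 2 * (1 + rConst) - √tConst = √(16 / √tConst - tConst) by rw [rConst]; ring,
        Real.sq_sqrt hrad, hs2]

theorem pow_four_sub_eight_mul_le {x y : ℝ} (hx : 1 ≤ x) (hy : 3 / 2 ≤ y) (hxy : x ≤ y) :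
    x ^ 4 - 8 * x ≤ y ^ 4 - 8 * y := by
  have hx3 : 1 ^ 3 ≤ x ^ 3 := by gcongr
  have hx2y : 1 ^ 2 * (3 / 2) ≤ x ^ 2 * y := by gcongr
  have hxy2 : 1 * (3 / 2) ^ 2 ≤ x * y ^ 2 := by gcongr
  have hy3 : (3 / 2) ^ 3 ≤ y ^ 3 := by gcongr
  have hslope : 0 ≤ x ^ 3 + x ^ 2 * y + x * y ^ 2 + y ^ 3 - 8 := by linarith
  linarith [mul_nonneg (sub_nonneg.2 hxy) hslope]

theorem rConst_mem_Ioo : rConst ∈ Ioo 0.79353 0.7936 := by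
  obtain ⟨hpos, hquartic⟩ := rConst_pos_and_quartic
  constructor
  · by_contra! hle
    linarith [pow_four_sub_eight_mul_le (x := 1 + rConst) (y := 1.79353) (by linarith)
      (by norm_num) (by linarith)]
  · by_contra! hle
    linarith [pow_four_sub_eight_mul_le (x := 1.7936) (y := 1 + rConst) (by norm_num)
      (by linarith) (by linarith)]

theorem half_one_add_inv_rConst_mem_Ioo :
    (1 / 2 : ℝ) * (1 + 1 / rConst) ∈ Ioo 1.1300 1.1301 := by
  obtain ⟨hlb, hub⟩ := rConst_mem_Ioo
  have hpos := rConst_pos_and_quartic.1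
  have hinv_lb : 1.26 < 1 / rConst := by rw [lt_div_iff₀ hpos]; linarith
  have hinv_ub : 1 / rConst < 1.2602 := by rw [div_lt_iff₀ hpos]; linarith
  constructor <;> linarith

theorem rConst_sq_add_sq : rConst ^ 2 + ((1 + rConst) ^ 2 / 2 - 1) ^ 2 = 1 := by
  linear_combination rConst_pos_and_quartic.2 / 4

theorem sqrt_one_sub_rConst_sq : √(1 - rConst ^ 2) = (1 + rConst) ^ 2 / 2 - 1 := by
  rw [← eq_sub_of_add_eq' rConst_sq_add_sq, Real.sqrt_sq]
  nlinarith [rConst_mem_Ioo.1]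

theorem monic_quadratic_neg_of_mem_Icc {a b p q s : ℝ} (hp : p ^ 2 + a * p + b < 0)
    (hq : q ^ 2 + a * q + b < 0) (hs : s ∈ Icc p q) : s ^ 2 + a * s + b < 0 := by
  rcases le_or_gt 0 (p + q + a) with h | h
  · nlinarith [mul_nonneg (sub_nonneg.2 hs.1) (sub_nonneg.2 hs.2),
      mul_nonneg h (sub_nonneg.2 hs.2)]
  · nlinarith [mul_nonneg (sub_nonneg.2 hs.1) (sub_nonneg.2 hs.2),
      mul_nonneg (neg_nonneg.2 h.le) (sub_nonneg.2 hs.1)]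

theorem sub_le_sq_sub_sq_of_one_add_sq_eq {ρ r m m₀ : ℝ} (hρ : 0 ≤ ρ) (hρr : ρ ≤ r)
    (hm : (1 + ρ) ^ 2 = 2 * (1 + m)) (hm₀ : (1 + r) ^ 2 = 2 * (1 + m₀)) (hm_half : 1 / 2 ≤ m) :
    r - ρ ≤ m₀ ^ 2 - m ^ 2 := by
  have hsub : m₀ - m = (r - ρ) * ((2 + r + ρ) / 2) := by linear_combination hm / 2 - hm₀ / 2
  have hle : r - ρ ≤ m₀ - m := by
    rw [hsub]
    exact le_mul_of_one_le_right (sub_nonneg.2 hρr) (by linarith)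
  calc r - ρ ≤ (m₀ - m) * 1 := by linarith
    _ ≤ (m₀ - m) * (m₀ + m) := mul_le_mul_of_nonneg_left (by linarith) (by linarith)
    _ = m₀ ^ 2 - m ^ 2 := by ring

theorem two_mul_rConst_le_of_quadratic {ρ m s : ℝ} (hρ : 0 ≤ ρ) (hρr : ρ < rConst)
    (hm : (1 + ρ) ^ 2 = 2 * (1 + m)) (hm_half : 1 / 2 ≤ m) (hs : 2 * ρ ≤ s)
    (h : 4 * (1 - m ^ 2) * (m ^ 2 + ρ * s - ρ ^ 2) ≤ s ^ 2) : 2 * rConst ≤ s := by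
  obtain ⟨-, hr⟩ := rConst_mem_Ioo
  have hr_sq := rConst_sq_add_sq
  obtain ⟨m₀, hm₀⟩ : ∃ m₀, (1 + rConst) ^ 2 = 2 * (1 + m₀) :=
    ⟨(1 + rConst) ^ 2 / 2 - 1, by ring⟩
  rw [hm₀, mul_div_cancel_left₀ _ two_ne_zero, add_sub_cancel_left] at hr_sq
  have hδ := sub_le_sq_sub_sq_of_one_add_sq_eq hρ hρr.le hm hm₀ hm_half
  have hρ_half : 1 / 2 < ρ := by nlinarith
  have hm_sq : (1 / 2) ^ 2 ≤ m ^ 2 := by gcongr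
  have hρ_sq : ρ ^ 2 < rConst ^ 2 := by gcongr
  have hat_ρ : (2 * ρ) ^ 2 + -(4 * (1 - m ^ 2) * ρ) * (2 * ρ)
      + -(4 * (1 - m ^ 2) * (m ^ 2 - ρ ^ 2)) < 0 := by
    have hneg : m ^ 2 * (m ^ 2 + ρ ^ 2 - 1) < 0 :=
      mul_neg_of_pos_of_neg (by linarith) (by linarith)
    linarith
  have hat_r : (2 * rConst) ^ 2 + -(4 * (1 - m ^ 2) * ρ) * (2 * rConst)
      + -(4 * (1 - m ^ 2) * (m ^ 2 - ρ ^ 2)) < 0 := by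
    have hsmall : 3 * (rConst - ρ) < 1 := by linarith
    have hlt : (1 - m ^ 2) * (rConst - ρ) ^ 2 < m ^ 2 * (m₀ ^ 2 - m ^ 2) := by
      calc (1 - m ^ 2) * (rConst - ρ) ^ 2 ≤ 3 / 4 * (rConst - ρ) ^ 2 := by gcongr; linarith
        _ = 3 * (rConst - ρ) * ((rConst - ρ) / 4) := by ring
        _ < 1 * ((rConst - ρ) / 4) := mul_lt_mul_of_pos_right hsmall (by linarith)
        _ = (1 / 2) ^ 2 * (rConst - ρ) := by ring
        _ ≤ m ^ 2 * (m₀ ^ 2 - m ^ 2) := by gcongr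
    linear_combination 4 * hlt + 4 * m ^ 2 * hr_sq
  by_contra! hlt
  linarith [monic_quadratic_neg_of_mem_Icc hat_ρ hat_r ⟨hs, hlt.le⟩]

end HoodConstant

section PseudoComplete

theorem exists_strip_of_closedBall_subset {n : ℕ} {K : Set (EuclideanSpace ℝ (Fin n))}
    (hK : IsCompact K) {ρ : ℝ} (hρ : 0 ≤ ρ) (hρK : closedBall 0 ρ ⊆ K)
    {u : EuclideanSpace ℝ (Fin n)} (hu : u ≠ 0) :
    ∃ (e : EuclideanSpace ℝ (Fin n)) (H₁ H₂ : ℝ), ‖e‖ = 1 ∧ ρ ≤ H₁ ∧ ρ ≤ H₂ ∧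
      (∀ x ∈ K, inner ℝ e x ∈ Icc (-H₂) H₁) ∧ H₁ + H₂ ≤ breadth K (closedBall 0 1) u := by
  have := nontrivial_of_ne u 0 hu
  obtain ⟨e, he, heu⟩ := exists_norm_eq_one_norm_smul_eq u
  have hne : K.Nonempty := ⟨0, hρK (mem_closedBall_self hρ)⟩
  have hρe : ‖ρ • e‖ = ρ := by rw [norm_smul, he, mul_one, Real.norm_of_nonneg hρ]
  have hinner : inner ℝ e (ρ • e) = ρ := by
    rw [inner_smul_right, real_inner_self_eq_norm_sq, he, one_pow, mul_one]
  obtain ⟨x, hx, hmax⟩ := hK.exists_isMaxOn hne (f := fun x => inner ℝ e x) (by fun_prop)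
  obtain ⟨y, hy, hmin⟩ := hK.exists_isMinOn hne (f := fun x => inner ℝ e x) (by fun_prop)
  refine ⟨e, inner ℝ e x, -inner ℝ e y, he, ?_, ?_, fun v hv => ?_, ?_⟩
  · exact hinner.symm.trans_le (hmax (hρK (mem_closedBall_zero_iff.2 hρe.le)))
  · rw [le_neg, ← hinner, ← inner_neg_right]
    exact hmin (hρK (mem_closedBall_zero_iff.2 (by rw [norm_neg, hρe])))
  · rw [neg_neg]
    exact ⟨hmin hv, hmax hv⟩
  · refine le_of_mul_le_mul_right ?_ (norm_pos_iff.2 hu)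
    rw [← sub_eq_add_neg, ← inner_sub_right, mul_comm, ← real_inner_smul_left, heu]
    exact inner_sub_le_breadth_mul_norm hK.isBounded u hx hy

variable {K : Set (EuclideanSpace ℝ (Fin 2))}

theorem two_mul_rConst_le_breadth (hK : IsCompact K) {ρ : ℝ} (hρ : 0 ≤ ρ) (hρr : ρ < rConst)
    (hρK : closedBall 0 ρ ⊆ K) (hcontact : 0 ∈ convexHull ℝ (K ∩ sphere 0 1))
    (hdiam : diam K ≤ 1 + ρ) {u : EuclideanSpace ℝ (Fin 2)} (hu : u ≠ 0) :
    2 * rConst ≤ breadth K (closedBall 0 1) u := by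
  obtain ⟨w, z, hw, hz, hwz⟩ := exists_fin_stdSimplex_of_mem_convexHull hcontact (k := 3)
    (by rw [finrank_euclideanSpace_fin]; norm_num)
  have hbal : IsBalanced w z := ⟨hw, fun i => mem_sphere_zero_iff_norm.1 (hz i).2, hwz⟩
  obtain ⟨m, hm⟩ : ∃ m, (1 + ρ) ^ 2 = 2 * (1 + m) := ⟨(1 + ρ) ^ 2 / 2 - 1, by ring⟩
  have hinner (i j : Fin 3) : -m ≤ inner ℝ (z i) (z j) :=
    neg_le_inner_of_dist_le (hbal.norm_eq_one i) (hbal.norm_eq_one j)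
      ((dist_le_diam_of_mem hK.isBounded (hz i).1 (hz j).1).trans hdiam) hm
  have hm_half : 1 / 2 ≤ m := by
    have hcard := hbal.one_add_le_card_mul hinner
    rw [Fintype.card_fin] at hcard
    push_cast at hcard
    linarith
  have hm_sq : 2 * m ^ 2 ≤ 1 := by
    have hm_ub : m ≤ 0.7 := by nlinarith [rConst_mem_Ioo.2]
    nlinarith
  obtain ⟨e, H₁, H₂, he, hH₁, hH₂, hstrip, hbreadth⟩ :=
    exists_strip_of_closedBall_subset hK hρ hρK hu
  have : Fact (finrank ℝ (EuclideanSpace ℝ (Fin 2)) = 2) := ⟨finrank_euclideanSpace_fin⟩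
  have hquad : 4 * (1 - m ^ 2) * (m ^ 2 + ρ * (H₁ + H₂) - ρ ^ 2) ≤ (H₁ + H₂) ^ 2 := by
    refine le_trans ?_
      (hbal.four_mul_le_sq_of_mem_strip hinner hm_sq he fun i => hstrip _ (hz i).1)
    refine mul_le_mul_of_nonneg_left ?_ (by linarith)
    linarith [mul_nonneg (sub_nonneg.2 hH₁) (sub_nonneg.2 hH₂)]
  exact (two_mul_rConst_le_of_quadratic hρ hρr hm hm_half (by linarith) hquad).trans hbreadth

theorem IsPseudoComplete.diameter_div_width_le_of_circumradius_eq_one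
    (hK : IsPseudoComplete K (closedBall 0 1)) (hR : circumradius K (closedBall 0 1) = 1)
    (hrK : closedBall 0 (inradius K (closedBall 0 1)) ⊆ K) (hK1 : K ⊆ closedBall 0 1) :
    diameter K (closedBall 0 1) / width K (closedBall 0 1) ≤ 1 / 2 * (1 + 1 / rConst) := by
  have hρ := hK.1.inradius_pos
  obtain ⟨⟨-, hcomp, hint⟩, hD⟩ := hK
  have hr := rConst_pos_and_quartic.1
  rw [← hD, hR]
  generalize inradius K (closedBall 0 1) = ρ at *
  rcases lt_or_ge ρ rConst with hρr | hρr
  · have hcontact : 0 ∈ convexHull ℝ (K ∩ sphere 0 1) :=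
      center_mem_convexHull_inter_sphere hcomp hK1 fun t =>
        hR ▸ exists_circumradius_le_dist hcomp (hint.mono interior_subset) t
    have hw : 2 * rConst ≤ width K (closedBall 0 1) := le_width fun u =>
      two_mul_rConst_le_breadth hcomp hρ.le hρr hrK hcontact
        (by rw [← diameter_eq_diam hcomp.isBounded, ← hD, hR, add_comm])
    calc (ρ + 1) / width K (closedBall 0 1) ≤ (rConst + 1) / (2 * rConst) := by gcongr
      _ = 1 / 2 * (1 + 1 / rConst) := by field
  · have hw : 2 * ρ ≤ width K (closedBall 0 1) := le_width fun u =>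
      two_mul_le_breadth hcomp.isBounded hρ.le hrK
    calc (ρ + 1) / width K (closedBall 0 1) ≤ (ρ + 1) / (2 * ρ) := by gcongr
      _ = 1 / 2 * (1 + 1 / ρ) := by field
      _ ≤ 1 / 2 * (1 + 1 / rConst) := by gcongr

theorem IsPseudoComplete.circumradius_pos {n : ℕ} [NeZero n] {K : Set (EuclideanSpace ℝ (Fin n))}
    (hK : IsPseudoComplete K (closedBall 0 1)) : 0 < circumradius K (closedBall 0 1) := by
  obtain ⟨u, hu⟩ := exists_ne (0 : EuclideanSpace ℝ (Fin n))
  have hbdd := hK.1.2.1.isBounded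
  obtain ⟨c, hrK⟩ := exists_closedBall_inradius_subset hK.1.2.1 (hK.1.2.2.mono interior_subset)
  have hrD : 2 * inradius K (closedBall 0 1) ≤ diameter K (closedBall 0 1) := by
    rw [diameter_eq_diam hbdd]
    exact (two_mul_le_breadth hbdd inradius_nonneg hrK hu).trans (breadth_le_diam hbdd)
  linarith [hK.2, hK.1.inradius_pos]

theorem IsPseudoComplete.diameter_div_width_le (hK : IsPseudoComplete K (closedBall 0 1)) :
    diameter K (closedBall 0 1) / width K (closedBall 0 1) ≤ 1 / 2 * (1 + 1 / rConst) := by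
  obtain ⟨c, hrK, hKR⟩ :=
    exists_concentric_closedBall hK.1.2.1 (hK.1.2.2.mono interior_subset)
  rw [← hK.2, add_sub_cancel_left] at hKR
  have hR := hK.circumradius_pos
  set a := (circumradius K (closedBall 0 1))⁻¹
  have ha : 0 < a := inv_pos.2 hR
  let e := IsometryEquiv.subRight c
  have hball (ρ : ℝ) : a • (e '' closedBall c ρ) = closedBall 0 (a * ρ) := by
    rw [e.image_closedBall, smul_closedBall' ha.ne', Real.norm_of_nonneg ha.le,
      IsometryEquiv.subRight_apply, sub_self, smul_zero]
  have haR : a * circumradius K (closedBall 0 1) = 1 := inv_mul_cancel₀ hR.ne'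
  rw [← diameter_div_width_smul_image ha e]
  refine (hK.smul_image ha e).diameter_div_width_le_of_circumradius_eq_one ?_ ?_ ?_
  · rw [circumradius_smul_image ha, haR]
  · rw [inradius_smul_image ha, ← hball]
    exact smul_set_mono (image_mono hrK)
  · rw [← haR, ← hball]
    exact smul_set_mono (image_mono hKR)

end PseudoComplete

section Hood

/-- The apex and the two feet of the hood: the contact points of the hood with its circumcircle. -/
def hoodVertices : Set (EuclideanSpace ℝ (Fin 2)) :=
  {!₂[0, 1], !₂[rConst, -√(1 - rConst ^ 2)], !₂[-rConst, -√(1 - rConst ^ 2)]}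

theorem hood_eq : hood = convexHull ℝ (hoodVertices ∪ closedBall 0 rConst) := by
  rw [hood, hoodVertices, unitDisk, smul_unitClosedBall,
    Real.norm_of_nonneg rConst_pos_and_quartic.1.le]

theorem isCompact_hood : IsCompact hood := by
  rw [hood_eq]
  refine isCompact_convexHull (IsCompact.union (Set.Finite.isCompact ?_) (isCompact_closedBall 0 _))
  exact ((finite_singleton _).insert _).insert _

theorem closedBall_subset_hood : closedBall 0 rConst ⊆ hood := by
  rw [hood_eq]
  exact subset_union_right.trans (subset_convexHull ℝ _)

theorem hoodVertices_subset_hood : hoodVertices ⊆ hood := by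
  rw [hood_eq]
  exact subset_union_left.trans (subset_convexHull ℝ _)

theorem isBody_hood : IsBody hood := by
  refine ⟨convex_convexHull ℝ _, isCompact_hood, ⟨0, ?_⟩⟩
  exact mem_interior_iff_mem_nhds.2 (Filter.mem_of_superset
    (closedBall_mem_nhds 0 rConst_pos_and_quartic.1) closedBall_subset_hood)

theorem sq_sqrt_one_sub_rConst_sq : √(1 - rConst ^ 2) ^ 2 = 1 - rConst ^ 2 := by
  rw [sqrt_one_sub_rConst_sq]
  exact eq_sub_of_add_eq' rConst_sq_add_sq

theorem hoodVertices_subset_sphere : hoodVertices ⊆ sphere 0 1 := by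
  rintro x (rfl | rfl | rfl) <;>
    simp [EuclideanSpace.norm_eq, Fin.sum_univ_two, sq_sqrt_one_sub_rConst_sq]

theorem zero_mem_convexHull_hoodVertices : 0 ∈ convexHull ℝ hoodVertices := by
  set m := √(1 - rConst ^ 2) with hm
  refine mem_convexHull_of_exists_fintype
    ![m / (1 + m), 1 / (2 * (1 + m)), 1 / (2 * (1 + m))]
    ![!₂[0, 1], !₂[rConst, -m], !₂[-rConst, -m]] ?_ ?_ ?_ ?_
  · intro i
    fin_cases i
    exacts [show 0 ≤ m / (1 + m) by positivity, show 0 ≤ 1 / (2 * (1 + m)) by positivity,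
      show 0 ≤ 1 / (2 * (1 + m)) by positivity]
  · rw [Fin.sum_univ_three]
    change m / (1 + m) + 1 / (2 * (1 + m)) + 1 / (2 * (1 + m)) = 1
    field
  · intro i
    fin_cases i <;> simp [hoodVertices, hm]
  · ext i
    rw [Fin.sum_univ_three]
    fin_cases i
    · change m / (1 + m) * 0 + 1 / (2 * (1 + m)) * rConst + 1 / (2 * (1 + m)) * -rConst = 0
      ring
    · change m / (1 + m) * 1 + 1 / (2 * (1 + m)) * -m + 1 / (2 * (1 + m)) * -m = 0
      field

theorem dist_le_of_mem_hoodVertices {x y : EuclideanSpace ℝ (Fin 2)} (hx : x ∈ hoodVertices)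
    (hy : y ∈ hoodVertices) : dist x y ≤ 1 + rConst := by
  obtain ⟨hr, hr1⟩ := rConst_mem_Ioo
  have hdist (a b a' b' : ℝ) : dist !₂[a, b] !₂[a', b'] = √((a - a') ^ 2 + (b - b') ^ 2) := by
    simp [EuclideanSpace.dist_eq, Fin.sum_univ_two, Real.dist_eq, sq_abs]
  have hleg : rConst ^ 2 + (1 + √(1 - rConst ^ 2)) ^ 2 = (1 + rConst) ^ 2 := by
    rw [sqrt_one_sub_rConst_sq]
    linear_combination rConst_sq_add_sq
  have hfeet : (2 * rConst) ^ 2 ≤ (1 + rConst) ^ 2 := by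
    gcongr
    linarith
  rcases hx with rfl | rfl | rfl <;> rcases hy with rfl | rfl | rfl <;> rw [hdist] <;>
    exact Real.sqrt_le_iff.2 ⟨by linarith, by linarith [sq_nonneg (1 + rConst)]⟩

theorem diameter_hood_le : diameter hood (closedBall 0 1) ≤ 1 + rConst := by
  obtain ⟨hr, hr1⟩ := rConst_mem_Ioo
  have hdist_ball {x y : EuclideanSpace ℝ (Fin 2)} (hx : dist x 0 ≤ 1) (hy : dist y 0 ≤ rConst) :
      dist x y ≤ 1 + rConst :=
    (dist_triangle_right x y 0).trans (add_le_add hx hy)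
  have hvertex {x} (hx : x ∈ hoodVertices) : dist x 0 ≤ 1 := (hoodVertices_subset_sphere hx).le
  rw [diameter_eq_diam isCompact_hood.isBounded, hood_eq, convexHull_diam]
  refine diam_le_of_forall_dist_le (by linarith) ?_
  rintro x (hx | hx) y (hy | hy)
  · exact dist_le_of_mem_hoodVertices hx hy
  · exact hdist_ball (hvertex hx) hy
  · exact dist_comm x y ▸ hdist_ball (hvertex hy) hx
  · exact hdist_ball ((mem_closedBall.1 hx).trans (by linarith)) hy

theorem abs_apply_zero_le_of_mem_hood {x : EuclideanSpace ℝ (Fin 2)} (hx : x ∈ hood) :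
    |x 0| ≤ rConst := by
  have hr := rConst_pos_and_quartic.1
  have hconv : Convex ℝ {x : EuclideanSpace ℝ (Fin 2) | |x 0| ≤ rConst} := by
    simp_rw [abs_le]
    exact (convex_Icc (-rConst) rConst).linear_preimage
      (EuclideanSpace.proj (0 : Fin 2) : EuclideanSpace ℝ (Fin 2) →L[ℝ] ℝ).toLinearMap
  rw [hood_eq] at hx
  refine convexHull_min ?_ hconv hx
  rintro y ((rfl | rfl | rfl) | hy)
  · simp [hr.le]
  · simp [abs_of_pos hr]
  · simp [abs_of_pos hr]
  · exact (PiLp.norm_apply_le y 0).trans (mem_closedBall_zero_iff.1 hy)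

theorem width_hood : width hood (closedBall 0 1) = 2 * rConst := by
  have hr := rConst_pos_and_quartic.1
  apply le_antisymm
  · let e : EuclideanSpace ℝ (Fin 2) := EuclideanSpace.single 0 1
    have he : e ≠ 0 := by simp [e]
    refine (width_le_breadth he).trans (breadth_le (by positivity) fun x hx y hy => ?_)
    have hxy : inner ℝ e (x - y) = x 0 - y 0 := by simp [e, EuclideanSpace.inner_single_left]
    rw [hxy, PiLp.norm_single, norm_one]
    linarith [abs_le.1 (abs_apply_zero_le_of_mem_hood hx),
      abs_le.1 (abs_apply_zero_le_of_mem_hood hy)]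
  · exact le_width fun u =>
      two_mul_le_breadth isCompact_hood.isBounded hr.le closedBall_subset_hood

theorem one_le_circumradius_hood : 1 ≤ circumradius hood (closedBall 0 1) := by
  refine le_circumradius isCompact_hood.isBounded fun t => ?_
  obtain ⟨x, hx, hxt⟩ := exists_le_dist_of_mem_convexHull hoodVertices_subset_sphere
    zero_mem_convexHull_hoodVertices t
  exact ⟨x, hoodVertices_subset_hood hx, hxt⟩

theorem one_add_rConst_le_inradius_add_circumradius_hood :
    1 + rConst ≤ inradius hood (closedBall 0 1) + circumradius hood (closedBall 0 1) := by
  linarith [le_inradius isCompact_hood.isBounded closedBall_subset_hood, one_le_circumradius_hood]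

theorem isPseudoComplete_hood : IsPseudoComplete hood (closedBall 0 1) :=
  ⟨isBody_hood, le_antisymm
    (inradius_add_circumradius_le_diameter isCompact_hood (isBody_hood.2.2.mono interior_subset))
    (diameter_hood_le.trans one_add_rConst_le_inradius_add_circumradius_hood)⟩

theorem diameter_hood : diameter hood (closedBall 0 1) = 1 + rConst :=
  le_antisymm diameter_hood_le
    (one_add_rConst_le_inradius_add_circumradius_hood.trans_eq isPseudoComplete_hood.2)

theorem IsHood.isPseudoComplete {K : Set (EuclideanSpace ℝ (Fin 2))} (hK : IsHood K) :
    IsPseudoComplete K (closedBall 0 1) := by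
  obtain ⟨c, e, hc, rfl⟩ := hK
  exact isPseudoComplete_hood.smul_image hc e

theorem IsHood.diameter_div_width {K : Set (EuclideanSpace ℝ (Fin 2))} (hK : IsHood K) :
    diameter K (closedBall 0 1) / width K (closedBall 0 1) = 1 / 2 * (1 + 1 / rConst) := by
  obtain ⟨c, e, hc, rfl⟩ := hK
  have hr := rConst_pos_and_quartic.1
  rw [diameter_div_width_smul_image hc, diameter_hood, width_hood]
  field

end Hood

end MinkowskiGeom

theorem theorem1p5 :
    (∀ K : Set (EuclideanSpace ℝ (Fin 2)),
      MinkowskiGeom.IsPseudoComplete K MinkowskiGeom.unitDisk →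
        MinkowskiGeom.diameter K MinkowskiGeom.unitDisk /
            MinkowskiGeom.width K MinkowskiGeom.unitDisk
          ≤ (1 / 2 : ℝ) * (1 + 1 / MinkowskiGeom.rConst)) ∧
    (∀ K : Set (EuclideanSpace ℝ (Fin 2)),
      MinkowskiGeom.IsHood K →
        MinkowskiGeom.IsPseudoComplete K MinkowskiGeom.unitDisk ∧
        MinkowskiGeom.diameter K MinkowskiGeom.unitDisk /
            MinkowskiGeom.width K MinkowskiGeom.unitDisk
          = (1 / 2 : ℝ) * (1 + 1 / MinkowskiGeom.rConst)) ∧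
    ((0.7935 : ℝ) < MinkowskiGeom.rConst ∧ MinkowskiGeom.rConst < 0.7936) ∧
    ((1.1300 : ℝ) < (1 / 2 : ℝ) * (1 + 1 / MinkowskiGeom.rConst) ∧
      (1 / 2 : ℝ) * (1 + 1 / MinkowskiGeom.rConst) < 1.1301) := by
  have ⟨hr, hr'⟩ := MinkowskiGeom.rConst_mem_Ioo
  exact ⟨fun K hK => hK.diameter_div_width_le,
    fun K hK => ⟨hK.isPseudoComplete, hK.diameter_div_width⟩,
    ⟨by linarith, hr'⟩, MinkowskiGeom.half_one_add_inv_rConst_mem_Ioo⟩
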